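/- \textbf{Bounds on the average guesswork under online attacks, without bin allocation.} All logarithms are to base $2$. Write $H(s)=-s\log s-(1-s)\log(1-s)$ and $D(q\|p)=q\log\frac{q}{p}+(1-q)\log\frac{1-q}{1-p}$, with $0\log 0=0$. Let $0<p\le 1/2$, $1/2\le s\le 1$ and $\epsilon>0$, and for every $m\in\mathbb N$ let $n=n(m)$ be an integer with $n\ge(1+\epsilon)\,m\log(1/p)$. For every $m$ let $h$ be a (fixed, unmodified) hash function from $\{1,\dots,2^n\}$ to the set of bins $\{0,1\}^m$, and let $P_H(b)=2^{-n}\,|\{x: h(x)=b\}|$ be its fractions of mappings. Assume that $P_H$ represents drawing $m$ bits i.i.d. Bernoulli$(p)$: for every bin $b$ with $k(b)$ ones, $2^nP_H(b)$ equals $2^np^{k(b)}(1-p)^{m-k(b)}$, rounded up or down to an integer if it is not one, i.e. $|2^nP_H(b)-2^np^{k(b)}(1-p)^{m-k(b)}|<1$. The users are mapped to different bins; let $B=B_m$ be the set of their bins, a nonempty set of bins whose size $M=|B|$ is $2^{H(s)m-1}$, rounded up or down to an integer if it is not one, i.e. $|M-2^{H(s)m-1}|<1$. Apart from this, $B$ is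 arbitrary. A strategy is an ordering of all $2^n$ inputs. The guesswork $G(b)$ of a bin $b$ is the number of guesses which a strategy needs in order to find an input that the hash function maps to $b$, and $$E(G_T(B))=\frac1M\sum_{b\in B}E(G(b)),$$ where $E(G(b))$ is either (a) the average of $G(b)$ over all strategies, uniformly distributed, for the given hash function $h$; or (b) the average of $G(b)$ over all hash functions with the same fractions of mappings $P_H$, uniformly distributed, for any given strategy, which may depend on $b$ (the attacker knows which bin belongs to which user). Then, in each of the cases (a) and (b), $$H(s)+D(1-s\|p)\;\le\;\liminf_{m\to\infty}\frac1m\log E(G_T(B))\;\le\;\limsup_{m\to\infty}\frac1m\log E(G_T(B))\;\le\;\begin{cases}H(s)+D(s\|p), & 1-p\le s\le 1,\\ 2H(p)+D(1-p\|p)-H(s), & 1/2\le s\le 1-p.\end{cases}$$ -/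

import Mathlib

namespace Guesswork

/-- Bins: the `m`-bit outputs of a hash function. -/
abbrev Bin (m : ℕ) : Type := Fin m → Bool

/-- Hash functions from `n`-bit inputs (numbered by `Fin (2 ^ n)`) to `m`-bit outputs. -/
abbrev HashFn (n m : ℕ) : Type := Fin (2 ^ n) → Bin m

/-- A strategy of guessing passwords one by one: an order on all the inputs;
`σ i` is the guess number `i + 1`. -/
abbrev Strategy (n : ℕ) : Type := Equiv.Perm (Fin (2 ^ n))

/-- The fraction of mappings of `h` to the bin `b`. -/
noncomputable def fraction {n m : ℕ} (h : HashFn n m) (b : Bin m) : ℝ :=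
  ((Finset.univ.filter fun x => h x = b).card : ℝ) / 2 ^ n

/-- The number of ones in `b`. -/
def ones {m : ℕ} (b : Bin m) : ℕ := (Finset.univ.filter fun i => b i = true).card

/-- The probability of obtaining `b` when drawing `m` bits i.i.d. Bernoulli(`p`). -/
noncomputable def bernoulliProb {m : ℕ} (p : ℝ) (b : Bin m) : ℝ :=
  p ^ ones b * (1 - p) ^ (m - ones b)

/-- The fractions of mappings of `h` represent drawing `m` bits i.i.d. Bernoulli(`p`): the number
of inputs mapped to each bin is `2 ^ n` times the Bernoulli probability of the bin, rounded (up or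
down) to an integer when it is not one. -/
def RepresentsBernoulli {n m : ℕ} (p : ℝ) (h : HashFn n m) : Prop :=
  ∀ b : Bin m, |2 ^ n * fraction h b - 2 ^ n * bernoulliProb p b| < 1

open Classical in
/-- The set of all hash functions with the same fractions of mappings as `h`. -/
noncomputable def hashSet {n m : ℕ} (h : HashFn n m) : Finset (HashFn n m) :=
  Finset.univ.filter fun h' => ∀ b, fraction h' b = fraction h b

/-- The guesswork of the bin `b`: the number of guesses that the strategy `σ` needs in order to find
an input which `h` maps to `b` (and `0` if there is no such input). -/
noncomputable def guesswork {n m : ℕ} (h : HashFn n m) (σ : Strategy n) (b : Bin m) : ℕ :=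
  sInf {k : ℕ | ∃ i : Fin (2 ^ n), h (σ i) = b ∧ k = (i : ℕ) + 1}

/-- The guesswork of `b` averaged uniformly over all strategies, for the fixed hash
function `h`. -/
noncomputable def strategyAverage {n m : ℕ} (h : HashFn n m) (b : Bin m) : ℝ :=
  (∑ σ : Strategy n, (guesswork h σ b : ℝ)) / (Fintype.card (Strategy n) : ℝ)

/-- The guesswork of `b` averaged uniformly over all hash functions with the same fractions of
mappings as `h`, for the fixed strategy `σ`. -/
noncomputable def hashSetAverage {n m : ℕ} (h : HashFn n m) (σ : Strategy n) (b : Bin m) : ℝ :=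
  (∑ h' ∈ hashSet h, (guesswork h' σ b : ℝ)) / ((hashSet h).card : ℝ)

/-- The average guesswork across users, when `B` is the set of the (distinct) bins of the users
and `g b` is the average guesswork of the bin `b`. -/
noncomputable def userAverage {m : ℕ} (B : Finset (Bin m)) (g : Bin m → ℝ) : ℝ :=
  (∑ b ∈ B, g b) / (B.card : ℝ)

/-- The exponential rate (base `2`) of a quantity at output length `m`. -/
noncomputable def rate (m : ℕ) (x : ℝ) : ℝ := 1 / (m : ℝ) * Real.logb 2 x

/-- Binary Shannon entropy, in bits. -/
noncomputable def entropy (s : ℝ) : ℝ := -s * Real.logb 2 s - (1 - s) * Real.logb 2 (1 - s)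

/-- Binary Kullback-Leibler divergence `D(q||p)`, in bits. -/
noncomputable def divergence (q p : ℝ) : ℝ :=
  q * Real.logb 2 (q / p) + (1 - q) * Real.logb 2 ((1 - q) / (1 - p))

/-- The lower bound on the rate. -/
noncomputable def lowerRate (s p : ℝ) : ℝ := entropy s + divergence (1 - s) p

/-- The upper bound on the rate. -/
noncomputable def upperRate (s p : ℝ) : ℝ :=
  if 1 - p ≤ s then entropy s + divergence s p
  else 2 * entropy p + divergence (1 - p) p - entropy s

end Guesswork

namespace Guesswork

/-! In a random order, an input outside a bin with `K` preimages precedes all of them with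
probability `1/(K+1)`, so the mean guesswork is exactly `(2^n+1)/(K+1)` (`strategyAverage_eq`).
Permuting inputs preserves the fractions, so case (b) reduces to case (a). As `n` is large, this
mean is `1/q(b)` up to constants, where `q` is the Bernoulli(`p`) weight.

It remains to average `1/q` over a set `B` of at least `2^(H(s)m)/4` bins. Lower bound: by Jensen,
the log of the average is at least an increasing affine function of the mean number of ones, and a
set this large has mean at least about `(1-s)m` (`exists_mean_ones_ge`). Upper bound
(`sum_inv_bernoulliProb_le`): if `s ≥ 1-p`, dominate `1/q` by a constant plus a multiple of the
Bernoulli(`s`) weight; otherwise sum over all bins. -/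

/-! ### Mean guesswork over all orders -/

/-- The inputs outside the bin `b` that the strategy `σ` tries before all the inputs in `b`. -/
def missesBefore {n m : ℕ} (h : HashFn n m) (σ : Strategy n) (b : Bin m) :
    Finset (Fin (2 ^ n)) :=
  Finset.univ.filter fun y => h y ≠ b ∧ ∀ z, h z = b → σ.symm y < σ.symm z

theorem guesswork_eq_card_missesBefore {n m : ℕ} (h : HashFn n m) (σ : Strategy n) (b : Bin m)
    (hb : ∃ x, h x = b) : guesswork h σ b = (missesBefore h σ b).card + 1 := by
  classical
  obtain ⟨x, hx⟩ := hb
  have hne : (Finset.univ.filter fun i => h (σ i) = b).Nonempty :=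
    ⟨σ.symm x, by simp [hx]⟩
  obtain ⟨i₀, hi₀, hmin⟩ := Finset.exists_min_image _ id hne
  simp only [Finset.mem_filter, Finset.mem_univ, true_and, id] at hi₀ hmin
  have hcard : (missesBefore h σ b).card = i₀ := by
    have : missesBefore h σ b = (Finset.Iio i₀).map σ.toEmbedding := by
      ext y
      simp only [missesBefore, Finset.mem_filter, Finset.mem_univ, true_and, Finset.mem_map_equiv,
        Finset.mem_Iio]
      constructor
      · rintro ⟨-, hy⟩
        simpa using hy (σ i₀) hi₀
      · intro hy
        refine ⟨fun hyb => ?_, fun z hz => hy.trans_le (hmin _ (by simpa using hz))⟩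
        exact absurd (hmin (σ.symm y) (by simpa using hyb)) (not_le.mpr hy)
    rw [this, Finset.card_map, Fin.card_Iio]
  rw [hcard]
  refine le_antisymm (Nat.sInf_le ⟨i₀, hi₀, rfl⟩) (le_csInf ⟨_, i₀, hi₀, rfl⟩ ?_)
  rintro k ⟨i, hi, rfl⟩
  exact Nat.succ_le_succ (hmin i hi)

/-- Each element of a finite set is the earliest one for the same number of permutations. -/
theorem card_mul_card_filter_forall_lt {α : Type*} [Fintype α] [LinearOrder α] (T : Finset α)
    (y : α) (hy : y ∈ T) :
    T.card * (Finset.univ.filter fun σ : Equiv.Perm α =>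
      ∀ z ∈ T, σ.symm y ≤ σ.symm z).card = Fintype.card (Equiv.Perm α) := by
  classical
  let A : α → Finset (Equiv.Perm α) := fun w =>
    Finset.univ.filter fun σ : Equiv.Perm α => ∀ z ∈ T, σ.symm w ≤ σ.symm z
  have hA : ∀ w ∈ T, (A w).card = (A y).card := by
    intro w hw
    have hT : ∀ z ∈ T, Equiv.swap y w z ∈ T := by
      intro z hz
      by_cases h1 : z = y
      · subst h1; simpa using hw
      by_cases h2 : z = w
      · subst h2; simpa using hy
      rwa [Equiv.swap_apply_of_ne_of_ne h1 h2]
    refine Finset.card_bij' (fun σ _ => Equiv.swap y w * σ) (fun σ _ => Equiv.swap y w * σ)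
      ?_ ?_ ?_ ?_
    · intro σ hσ
      simp only [A, Finset.mem_filter, Finset.mem_univ, true_and] at hσ ⊢
      intro z hz
      have := hσ _ (hT z hz)
      simpa [← Equiv.Perm.inv_def, mul_inv_rev] using this
    · intro σ hσ
      simp only [A, Finset.mem_filter, Finset.mem_univ, true_and] at hσ ⊢
      intro z hz
      have := hσ _ (hT z hz)
      simpa [← Equiv.Perm.inv_def, mul_inv_rev] using this
    · intro σ _; simp [← mul_assoc]
    · intro σ _; simp [← mul_assoc]
  have hdisj : (T : Set α).PairwiseDisjoint A := by
    intro u hu v hv huv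
    refine Finset.disjoint_left.mpr fun σ h1 h2 => huv ?_
    simp only [A, Finset.mem_filter, Finset.mem_univ, true_and] at h1 h2
    exact σ.symm.injective (le_antisymm (h1 v hv) (h2 u hu))
  have hunion : T.biUnion A = Finset.univ := by
    refine Finset.eq_univ_of_forall fun σ => ?_
    obtain ⟨w, hw, hmin⟩ := Finset.exists_min_image T (fun z => σ.symm z) ⟨y, hy⟩
    exact Finset.mem_biUnion.mpr ⟨w, hw, by simpa [A] using hmin⟩
  calc T.card * (A y).card = ∑ w ∈ T, (A w).card := by
        rw [Finset.sum_congr rfl hA, Finset.sum_const, smul_eq_mul]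
    _ = (T.biUnion A).card := (Finset.card_biUnion hdisj).symm
    _ = _ := by rw [hunion, Finset.card_univ]

/-- An outside input `y` is a miss exactly when it comes first in the bin enlarged by `y`, which
holds for one order in `K+1`. -/
theorem sum_guesswork {n m : ℕ} (h : HashFn n m) (b : Bin m) (hb : ∃ x, h x = b) :
    ((Finset.univ.filter fun x => h x = b).card + 1) * ∑ σ : Strategy n, guesswork h σ b =
      (2 ^ n + 1) * Fintype.card (Strategy n) := by
  classical
  set S := Finset.univ.filter fun x => h x = b with hS
  have hswap : ∑ σ : Strategy n, (missesBefore h σ b).card =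
      ∑ y ∈ Sᶜ, (Finset.univ.filter fun σ : Strategy n =>
        ∀ z, h z = b → σ.symm y < σ.symm z).card := by
    simp only [missesBefore, Finset.card_filter, ite_and]
    rw [Finset.sum_comm]
    simp [hS, Finset.compl_filter, Finset.sum_filter]
  have hterm : ∀ y ∈ Sᶜ, (S.card + 1) * (Finset.univ.filter fun σ : Strategy n =>
        ∀ z, h z = b → σ.symm y < σ.symm z).card = Fintype.card (Strategy n) := by
    intro y hy
    have hyS : y ∉ S := Finset.mem_compl.mp hy
    rw [← Finset.card_insert_of_notMem hyS,
      ← card_mul_card_filter_forall_lt (insert y S) y (Finset.mem_insert_self _ _)]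
    congr 2
    ext σ
    simp only [Finset.mem_filter, Finset.mem_univ, true_and, Finset.forall_mem_insert, le_refl, hS]
    refine forall₂_congr fun z hz => ⟨le_of_lt, fun hle => lt_of_le_of_ne hle fun he => hyS ?_⟩
    rw [σ.symm.injective he, hS]
    simpa using hz
  have hle : S.card ≤ 2 ^ n := by simpa using Finset.card_le_univ S
  simp only [guesswork_eq_card_missesBefore h _ b hb]
  rw [Finset.sum_add_distrib, mul_add, hswap, Finset.mul_sum, Finset.sum_congr rfl hterm]
  simp only [Finset.sum_const, smul_eq_mul, Finset.card_univ, mul_one, Finset.card_compl,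
    Fintype.card_fin]
  rw [← add_mul]
  congr 1
  omega

theorem strategyAverage_eq {n m : ℕ} (h : HashFn n m) (b : Bin m) (hb : ∃ x, h x = b) :
    strategyAverage h b = (2 ^ n + 1) / (2 ^ n * fraction h b + 1) := by
  have h1 := sum_guesswork h b hb
  have h2 : (2 : ℝ) ^ n * fraction h b = ((Finset.univ.filter fun x => h x = b).card : ℝ) := by
    rw [fraction]; field_simp
  have h3 : (0 : ℝ) < Fintype.card (Strategy n) := by exact_mod_cast Fintype.card_pos
  rw [h2, strategyAverage, div_eq_div_iff h3.ne' (by positivity), mul_comm]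
  exact_mod_cast h1

/-! ### Mean guesswork over hash functions -/

theorem fraction_comp_perm {n m : ℕ} (h : HashFn n m) (π : Strategy n) (b : Bin m) :
    fraction (h ∘ π) b = fraction h b := by
  classical
  rw [fraction, fraction]
  congr 2
  refine Finset.card_bij' (fun x _ => π x) (fun x _ => π.symm x) ?_ ?_ ?_ ?_ <;> simp

theorem guesswork_comp_perm {n m : ℕ} (h : HashFn n m) (π σ : Strategy n) (b : Bin m) :
    guesswork (h ∘ π) σ b = guesswork h (π * σ) b := rfl

theorem fraction_pos_iff {n m : ℕ} (h : HashFn n m) (b : Bin m) :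
    0 < fraction h b ↔ ∃ x, h x = b := by
  rw [fraction, div_pos_iff_of_pos_right (by positivity), Nat.cast_pos, Finset.card_pos,
    Finset.filter_nonempty_iff]
  simp

/-- Averaging over the hash functions with given fractions of mappings is the same as averaging
over the strategies. -/
theorem hashSetAverage_eq_strategyAverage {n m : ℕ} (h : HashFn n m) (σ : Strategy n) (b : Bin m)
    (hb : ∃ x, h x = b) : hashSetAverage h σ b = strategyAverage h b := by
  classical
  have hmem : ∀ {h'}, h' ∈ hashSet h ↔ ∀ b, fraction h' b = fraction h b := by
    simp [hashSet]
  have hcard : (0 : ℝ) < (hashSet h).card := by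
    exact_mod_cast Finset.card_pos.mpr ⟨h, hmem.mpr fun _ => rfl⟩
  have hP : (0 : ℝ) < Fintype.card (Strategy n) := by exact_mod_cast Fintype.card_pos
  have hinner : ∀ π : Strategy n, ∑ h' ∈ hashSet h, (guesswork h' (π * σ) b : ℝ) =
      ∑ h' ∈ hashSet h, (guesswork h' σ b : ℝ) := by
    intro π
    refine Finset.sum_bij' (fun h' _ => h' ∘ π) (fun h' _ => h' ∘ π.symm) ?_ ?_ ?_ ?_ ?_
    · intro h' hh'
      exact hmem.mpr fun b => (fraction_comp_perm h' π b).trans (hmem.mp hh' b)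
    · intro h' hh'
      exact hmem.mpr fun b => (fraction_comp_perm h' π.symm b).trans (hmem.mp hh' b)
    · intro h' _; ext; simp
    · intro h' _; ext; simp
    · intro h' _; rw [guesswork_comp_perm]
  have houter : ∀ h' ∈ hashSet h, ∑ π : Strategy n, (guesswork h' (π * σ) b : ℝ) =
      Fintype.card (Strategy n) * strategyAverage h b := by
    intro h' hh'
    have hf := hmem.mp hh' b
    have hb' : ∃ x, h' x = b := by rwa [← fraction_pos_iff, hf, fraction_pos_iff]
    rw [strategyAverage_eq h b hb, ← hf, ← strategyAverage_eq h' b hb', strategyAverage,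
      mul_div_cancel₀ _ hP.ne']
    exact Equiv.sum_comp (Equiv.mulRight σ) fun τ : Strategy n => (guesswork h' τ b : ℝ)
  -- Sum `guesswork h' (π * σ) b` over all pairs `(π, h')` in both orders.
  have hdouble : (Fintype.card (Strategy n) : ℝ) * ∑ h' ∈ hashSet h, (guesswork h' σ b : ℝ) =
      (hashSet h).card * (Fintype.card (Strategy n) * strategyAverage h b) := by
    rw [← nsmul_eq_mul ((hashSet h).card), ← Finset.sum_const, ← Finset.sum_congr rfl houter,
      Finset.sum_comm, Finset.sum_congr rfl fun π _ => hinner π]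
    simp
  rw [hashSetAverage, div_eq_iff hcard.ne']
  refine mul_left_cancel₀ hP.ne' (hdouble.trans ?_)
  ring

/-! ### Bernoulli weights and closed forms of the rates -/

theorem ones_le {m : ℕ} (b : Bin m) : ones b ≤ m := by
  simpa [ones] using Finset.card_filter_le Finset.univ fun i => b i = true

theorem sum_pow_ones_mul_pow (m : ℕ) (x y : ℝ) :
    ∑ b : Bin m, x ^ ones b * y ^ (m - ones b) = (x + y) ^ m := by
  classical
  have := Fintype.sum_pow_mul_eq_add_pow (Fin m) x y
  rw [Fintype.card_fin] at this
  rw [← this]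
  refine Fintype.sum_bijective (fun b : Bin m => Finset.univ.filter fun i => b i = true) ?_ _ _
    fun b => rfl
  refine ⟨fun b c hbc => ?_, fun s => ⟨fun i => decide (i ∈ s), by ext; simp⟩⟩
  ext i
  simpa [Bool.coe_iff_coe] using Finset.ext_iff.mp hbc i

theorem sum_bernoulliProb (m : ℕ) (p : ℝ) : ∑ b : Bin m, bernoulliProb p b = 1 := by
  simp only [bernoulliProb]
  rw [sum_pow_ones_mul_pow]; simp

theorem bernoulliProb_nonneg {m : ℕ} {p : ℝ} (hp : 0 ≤ p) (hp1 : p ≤ 1) (b : Bin m) :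
    0 ≤ bernoulliProb p b :=
  mul_nonneg (pow_nonneg hp _) (pow_nonneg (sub_nonneg.mpr hp1) _)

theorem bernoulliProb_pos {m : ℕ} {p : ℝ} (hp : 0 < p) (hp1 : p < 1) (b : Bin m) :
    0 < bernoulliProb p b :=
  mul_pos (pow_pos hp _) (pow_pos (sub_pos.mpr hp1) _)

theorem logb_bernoulliProb {m : ℕ} {p : ℝ} (hp : 0 < p) (hp1 : p < 1) (b : Bin m) :
    Real.logb 2 (bernoulliProb p b) =
      ones b * Real.logb 2 p + (m - ones b) * Real.logb 2 (1 - p) := by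
  have h1 : 0 < 1 - p := sub_pos.mpr hp1
  rw [bernoulliProb, Real.logb_mul (by positivity) (by positivity), Real.logb_pow, Real.logb_pow,
    Nat.cast_sub (ones_le b)]

/-- The average guesswork of a bin is the inverse of its probability, up to constants. -/
theorem strategyAverage_bounds {n m : ℕ} {p ε : ℝ} (hp : 0 < p) (hp2 : p ≤ 1 / 2) (hε : 0 < ε)
    (hn : (1 + ε) * m * Real.logb 2 (1 / p) ≤ n) {h : HashFn n m} (hh : RepresentsBernoulli p h)
    (b : Bin m) :
    (∃ x, h x = b) ∧ (bernoulliProb p b)⁻¹ / 3 ≤ strategyAverage h b ∧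
      strategyAverage h b ≤ 2 * (bernoulliProb p b)⁻¹ := by
  have hq := bernoulliProb_pos hp (by linarith) b
  have hL : 0 ≤ Real.logb 2 (1 / p) :=
    Real.logb_nonneg one_lt_two (by rw [le_div_iff₀ hp]; linarith)
  have hpm : p ^ m ≤ bernoulliProb p b := by
    calc p ^ m = p ^ ones b * p ^ (m - ones b) := by
          rw [← pow_add, Nat.add_sub_cancel' (ones_le b)]
      _ ≤ _ := mul_le_mul_of_nonneg_left (pow_le_pow_left₀ hp.le (by linarith) _) (by positivity)
  -- Even the least possible weight, `p^m`, gives an expected count of at least one.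
  have hN : 1 ≤ (2 : ℝ) ^ n * bernoulliProb p b := by
    refine le_trans ?_ (mul_le_mul_of_nonneg_left hpm (by positivity))
    rw [← Real.logb_nonneg_iff one_lt_two (by positivity),
      Real.logb_mul (by positivity) (by positivity), Real.logb_pow, Real.logb_pow,
      Real.logb_self_eq_one one_lt_two]
    rw [one_div, Real.logb_inv] at hn hL
    nlinarith [mul_nonneg (mul_nonneg hε.le (Nat.cast_nonneg m)) hL]
  have habs := abs_lt.mp (hh b)
  have hpos : 0 < (2 : ℝ) ^ n * fraction h b := by linarith
  have hb : ∃ x, h x = b := (fraction_pos_iff h b).mp (pos_of_mul_pos_right hpos (by positivity))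
  have hN1 : (1 : ℝ) ≤ 2 ^ n := one_le_pow₀ one_le_two
  rw [strategyAverage_eq h b hb]
  -- With `x = 2^n q ≥ 1`, the count `K` satisfies `x < K+1 < x+2 ≤ 3x`, whence the `3`; the `2`
  -- comes from `2^n+1 ≤ 2·2^n`.
  refine ⟨hb, ?_, ?_⟩
  · rw [inv_eq_one_div, div_div, div_le_div_iff₀ (by positivity) (by positivity)]
    nlinarith
  · rw [← div_eq_mul_inv, div_le_div_iff₀ (by positivity) hq]
    nlinarith

theorem lowerRate_eq {s p : ℝ} (hp : 0 < p) (hp1 : p < 1) (hs : 0 < s) (hs1 : s ≤ 1) :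
    lowerRate s p = -(1 - s) * Real.logb 2 p - s * Real.logb 2 (1 - p) := by
  have h1 : 0 < 1 - p := sub_pos.mpr hp1
  rw [lowerRate, entropy, divergence, sub_sub_cancel, Real.logb_div hs.ne' h1.ne']
  rcases hs1.eq_or_lt with rfl | hs1
  · simp
  · rw [Real.logb_div (sub_pos.mpr hs1).ne' hp.ne']; ring

theorem entropy_add_divergence {s p : ℝ} (hp : 0 < p) (hp1 : p < 1) (hs : 0 < s) (hs1 : s ≤ 1) :
    entropy s + divergence s p = -s * Real.logb 2 p - (1 - s) * Real.logb 2 (1 - p) := by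
  have h1 : 0 < 1 - p := sub_pos.mpr hp1
  rw [entropy, divergence, Real.logb_div hs.ne' hp.ne']
  rcases hs1.eq_or_lt with rfl | hs1
  · simp
  · rw [Real.logb_div (sub_pos.mpr hs1).ne' h1.ne']; ring

theorem two_mul_entropy_add_divergence {p : ℝ} (hp : 0 < p) (hp1 : p < 1) :
    2 * entropy p + divergence (1 - p) p = -Real.logb 2 p - Real.logb 2 (1 - p) := by
  have h1 : 0 < 1 - p := sub_pos.mpr hp1
  rw [entropy, divergence, sub_sub_cancel, Real.logb_div h1.ne' hp.ne',
    Real.logb_div hp.ne' h1.ne']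
  ring

/-- Rounding loses at most a factor 2, since `M ≥ 1` and `M + 1 > 2^(x-1)` give `2M > 2^(x-1)`. -/
theorem div_four_le_of_abs_sub_lt {M : ℕ} (hM : 0 < M) {x : ℝ}
    (h : |(M : ℝ) - (2 : ℝ) ^ (x - 1)| < 1) : (2 : ℝ) ^ x / 4 ≤ M := by
  rw [Real.rpow_sub_one two_ne_zero] at h
  have h1 : (1 : ℝ) ≤ M := by exact_mod_cast hM
  have := (abs_lt.mp h).1
  linarith

/-! ### Upper bound -/

/-- Beyond the type `s ≥ 1 - p`, the inverse probabilities grow slower than the probabilities of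
Bernoulli(`s`) decay. -/
theorem inv_bernoulliProb_le {m : ℕ} {p s : ℝ} (hp : 0 < p) (hp2 : p ≤ 1 / 2) (hs : 1 - p ≤ s)
    (hs1 : s ≤ 1) (b : Bin m) :
    (bernoulliProb p b)⁻¹ ≤ 2 ^ ((entropy s + divergence s p) * m) *
      (1 + 2 ^ (entropy s * m) * bernoulliProb s b) := by
  have hp1 : p < 1 := by linarith
  have hs0 : 0 < s := by linarith
  have hq := bernoulliProb_pos hp hp1 b
  have hr := bernoulliProb_nonneg hs0.le hs1 b
  have hk : (ones b : ℝ) ≤ m := by exact_mod_cast ones_le b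
  have hqe : (bernoulliProb p b)⁻¹ =
      2 ^ (-(ones b * Real.logb 2 p + (m - ones b) * Real.logb 2 (1 - p))) := by
    rw [← logb_bernoulliProb hp hp1, Real.rpow_neg two_pos.le,
      Real.rpow_logb two_pos (by norm_num) hq]
  rw [entropy_add_divergence hp hp1 hs0 hs1]
  by_cases hks : (ones b : ℝ) ≤ s * m
  · refine le_trans ?_ (le_mul_of_one_le_right (by positivity)
      (le_add_of_nonneg_right (by positivity)))
    rw [hqe]
    refine Real.rpow_le_rpow_of_exponent_le one_le_two ?_
    have : Real.logb 2 p ≤ Real.logb 2 (1 - p) :=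
      Real.logb_le_logb_of_le one_lt_two hp (by linarith)
    nlinarith
  · push Not at hks
    have hs1' : s < 1 := by
      refine hs1.lt_of_ne ?_
      rintro rfl
      linarith
    have hre : bernoulliProb s b =
        2 ^ (ones b * Real.logb 2 s + (m - ones b) * Real.logb 2 (1 - s)) := by
      rw [← logb_bernoulliProb hs0 hs1',
        Real.rpow_logb two_pos (by norm_num) (bernoulliProb_pos hs0 hs1' b)]
    refine le_trans ?_ (mul_le_mul_of_nonneg_left (le_add_of_nonneg_left zero_le_one)
      (by positivity))
    rw [hqe, hre, ← Real.rpow_add two_pos, ← Real.rpow_add two_pos]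
    refine Real.rpow_le_rpow_of_exponent_le one_le_two ?_
    -- The two sides agree at `ones b = s * m`; this compares their slopes and amounts to `1 - p ≤
    -- s`.
    have hprod : Real.logb 2 (1 - p) + Real.logb 2 (1 - s) ≤ Real.logb 2 p + Real.logb 2 s := by
      rw [← Real.logb_mul (by linarith) (by linarith), ← Real.logb_mul hp.ne' hs0.ne']
      exact Real.logb_le_logb_of_le one_lt_two
        (mul_pos (by linarith) (by linarith)) (by nlinarith)
    rw [entropy]
    nlinarith [mul_nonneg (sub_nonneg.mpr hks.le) (sub_nonneg.mpr hprod)]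

theorem sum_inv_bernoulliProb_le {m : ℕ} {p s : ℝ} (hp : 0 < p) (hp2 : p ≤ 1 / 2)
    (hs : 1 / 2 ≤ s) (hs1 : s ≤ 1) (B : Finset (Bin m))
    (hB : (2 : ℝ) ^ (entropy s * m) / 4 ≤ B.card) :
    ∑ b ∈ B, (bernoulliProb p b)⁻¹ ≤ 5 * 2 ^ (upperRate s p * m) * B.card := by
  have hp1 : p < 1 := by linarith
  have h1p : 0 < 1 - p := by linarith
  rw [upperRate]
  split_ifs with hsp
  · calc ∑ b ∈ B, (bernoulliProb p b)⁻¹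
        ≤ ∑ b ∈ B, 2 ^ ((entropy s + divergence s p) * m) *
            (1 + 2 ^ (entropy s * m) * bernoulliProb s b) :=
          Finset.sum_le_sum fun b _ => inv_bernoulliProb_le hp hp2 hsp hs1 b
      _ = 2 ^ ((entropy s + divergence s p) * m) *
            (B.card + 2 ^ (entropy s * m) * ∑ b ∈ B, bernoulliProb s b) := by
          rw [← Finset.mul_sum, Finset.sum_add_distrib, ← Finset.mul_sum]; simp
      _ ≤ 2 ^ ((entropy s + divergence s p) * m) * (B.card + 2 ^ (entropy s * m) * 1) := by
          gcongr
          rw [← sum_bernoulliProb m s]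
          exact Finset.sum_le_sum_of_subset_of_nonneg (Finset.subset_univ _)
            fun b _ _ => bernoulliProb_nonneg (by linarith) hs1 b
      _ ≤ 2 ^ ((entropy s + divergence s p) * m) * (5 * B.card) := by
          gcongr
          linarith
      _ = _ := by ring
  · calc ∑ b ∈ B, (bernoulliProb p b)⁻¹ ≤ ∑ b : Bin m, (bernoulliProb p b)⁻¹ :=
          Finset.sum_le_sum_of_subset_of_nonneg (Finset.subset_univ _)
            fun b _ _ => inv_nonneg.mpr (bernoulliProb_nonneg hp.le hp1.le b)
      _ = (p⁻¹ + (1 - p)⁻¹) ^ m := by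
          rw [← sum_pow_ones_mul_pow]
          simp [bernoulliProb, mul_comm]
      _ = 2 ^ ((-Real.logb 2 p - Real.logb 2 (1 - p)) * m) := by
          rw [Real.rpow_mul_natCast two_pos.le, ← neg_add', neg_add, Real.rpow_add two_pos,
            Real.rpow_neg two_pos.le, Real.rpow_neg two_pos.le,
            Real.rpow_logb two_pos (by norm_num) hp, Real.rpow_logb two_pos (by norm_num) h1p]
          congr 1
          field_simp
          ring
      _ = 2 ^ ((2 * entropy p + divergence (1 - p) p - entropy s) * m) *
            2 ^ (entropy s * m) := by
          rw [← Real.rpow_add two_pos, two_mul_entropy_add_divergence hp hp1]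
          ring_nf
      _ ≤ 2 ^ ((2 * entropy p + divergence (1 - p) p - entropy s) * m) * (5 * B.card) := by
          gcongr
          linarith [(Nat.cast_nonneg B.card : (0 : ℝ) ≤ _)]
      _ = _ := by ring

/-! ### Lower bound -/

theorem sum_logb_le_card_mul_logb_userAverage {m : ℕ} {B : Finset (Bin m)} (hB : B.Nonempty)
    {f : Bin m → ℝ} (hf : ∀ b, 0 < f b) :
    ∑ b ∈ B, Real.logb 2 (f b) ≤ B.card * Real.logb 2 (userAverage B f) := by
  have hM : (0 : ℝ) < B.card := by exact_mod_cast hB.card_pos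
  have hl2 : 0 < Real.log 2 := Real.log_pos one_lt_two
  have := strictConcaveOn_log_Ioi.concaveOn.le_map_sum (t := B) (w := fun _ => (B.card : ℝ)⁻¹)
    (p := f) (fun _ _ => by positivity) (by simp [hM.ne']) (fun b _ => hf b)
  simp only [smul_eq_mul, ← Finset.mul_sum] at this
  rw [inv_mul_le_iff₀ hM, inv_mul_eq_div] at this
  simp only [Real.logb, userAverage, ← Finset.sum_div]
  rw [← mul_div_assoc]
  exact div_le_div_of_nonneg_right this hl2.le

/-- A large set of bins has many ones on average. -/
theorem mean_ones_ge {m : ℕ} {B : Finset (Bin m)} (hB : B.Nonempty) {t x : ℝ} (ht : 0 < t)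
    (ht1 : t < 1) (hx : (2 : ℝ) ^ x / 4 ≤ B.card) :
    m * Real.logb 2 t + x - 2 ≤
      userAverage B (fun b => (ones b : ℝ)) * (Real.logb 2 t - Real.logb 2 (1 - t)) := by
  have hM : (0 : ℝ) < B.card := by exact_mod_cast hB.card_pos
  have hpos : ∀ b : Bin m, 0 < bernoulliProb (1 - t) b :=
    bernoulliProb_pos (by linarith) (by linarith)
  -- The log-weight is affine in the number of ones, while the average weight over `B` is at most
  -- `1/|B| ≤ 2^(2-x)`.
  have hJ := sum_logb_le_card_mul_logb_userAverage hB hpos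
  have hsum : ∑ b ∈ B, Real.logb 2 (bernoulliProb (1 - t) b) = B.card *
      (m * Real.logb 2 t - userAverage B (fun b => (ones b : ℝ)) *
        (Real.logb 2 t - Real.logb 2 (1 - t))) := by
    simp only [logb_bernoulliProb (sub_pos.mpr ht1) (sub_lt_self 1 ht), sub_sub_cancel]
    have : ∀ b : Bin m, (ones b : ℝ) * Real.logb 2 (1 - t) + (m - ones b) * Real.logb 2 t =
        m * Real.logb 2 t - ones b * (Real.logb 2 t - Real.logb 2 (1 - t)) := fun b => by ring
    simp only [this, Finset.sum_sub_distrib, ← Finset.sum_mul, userAverage, Finset.sum_const,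
      nsmul_eq_mul]
    field_simp
  rw [hsum] at hJ
  have hJ' := le_of_mul_le_mul_left hJ hM
  have hle : userAverage B (bernoulliProb (1 - t)) ≤ 2 ^ (2 - x) := by
    rw [userAverage, div_le_iff₀ hM]
    calc ∑ b ∈ B, bernoulliProb (1 - t) b ≤ 1 := by
          exact (Finset.sum_le_sum_of_subset_of_nonneg (Finset.subset_univ _)
            fun b _ _ => (hpos b).le).trans_eq (sum_bernoulliProb m (1 - t))
      _ = 2 ^ (2 - x) * (2 ^ x / 4) := by
          rw [← mul_div_assoc, ← Real.rpow_add two_pos]; norm_num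
      _ ≤ _ := by gcongr
  have havg : 0 < userAverage B (bernoulliProb (1 - t)) :=
    div_pos (Finset.sum_pos (fun b _ => hpos b) hB) hM
  have := Real.logb_le_logb_of_le one_lt_two havg hle
  rw [Real.logb_rpow two_pos (by norm_num)] at this
  linarith

theorem entropy_half : entropy (1 / 2) = 1 := by
  rw [entropy, one_div, Real.logb_inv, show (1 : ℝ) - 2⁻¹ = 2⁻¹ by norm_num, Real.logb_inv,
    Real.logb_self_eq_one one_lt_two]
  norm_num

/-- For `1/2 < s < 1`, take `t = s` in `mean_ones_ge`: `H(s) + log s = (1-s)(log s - log(1-s))`. At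
`s = 1/2` that factor vanishes, so `t` is moved to `(1+x)/2`, at a cost `x/2 ≤ η`; at `s = 1` the
bound is trivial. -/
theorem exists_mean_ones_ge {s η : ℝ} (hs : 1 / 2 ≤ s) (hs1 : s ≤ 1) (hη : 0 < η) :
    ∃ C : ℝ, ∀ (m : ℕ) (B : Finset (Bin m)), B.Nonempty →
      (2 : ℝ) ^ (entropy s * m) / 4 ≤ B.card →
      (1 - s - η) * m - C ≤ userAverage B (fun b => (ones b : ℝ)) := by
  rcases hs.eq_or_lt with rfl | hs
  · obtain ⟨x, hx0, hx1, hxη⟩ : ∃ x : ℝ, 0 < x ∧ x < 1 ∧ x ≤ 2 * η :=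
      ⟨min (1 / 2) (2 * η), by positivity, by
        exact (min_le_left _ _).trans_lt (by norm_num), min_le_right _ _⟩
    have hl2 : 0 < Real.log 2 := Real.log_pos one_lt_two
    have hA : 0 < Real.logb 2 (1 + x) := Real.logb_pos one_lt_two (by linarith)
    have hD : Real.logb 2 (1 - x) < 0 := Real.logb_neg one_lt_two (by linarith) (by linarith)
    -- Equivalent to `(1+x) log(1+x) + (1-x) log(1-x) ≥ 0`, i.e. `H((1+x)/2) ≤ 1`; it follows from
    -- `log y ≥ 1 - 1/y`.
    have hratio : (1 - x) / 2 * (Real.logb 2 (1 + x) - Real.logb 2 (1 - x)) ≤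
        Real.logb 2 (1 + x) := by
      have h1 := Real.one_sub_inv_le_log_of_pos (show 0 < 1 + x by linarith)
      have h2 := Real.one_sub_inv_le_log_of_pos (show 0 < 1 - x by linarith)
      have h3 : x ≤ (1 + x) * Real.log (1 + x) := by
        have := mul_le_mul_of_nonneg_left h1 (show 0 ≤ 1 + x by linarith)
        rw [mul_sub, mul_inv_cancel₀ (by linarith)] at this
        linarith
      have h4 : -x ≤ (1 - x) * Real.log (1 - x) := by
        have := mul_le_mul_of_nonneg_left h2 (show 0 ≤ 1 - x by linarith)
        rw [mul_sub, mul_inv_cancel₀ (by linarith)] at this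
        linarith
      simp only [Real.logb]
      rw [← sub_div, ← mul_div_assoc]
      refine div_le_div_of_nonneg_right ?_ hl2.le
      linarith
    have ht : Real.logb 2 ((1 + x) / 2) = Real.logb 2 (1 + x) - 1 := by
      rw [Real.logb_div (by linarith) two_ne_zero, Real.logb_self_eq_one one_lt_two]
    have ht' : Real.logb 2 (1 - (1 + x) / 2) = Real.logb 2 (1 - x) - 1 := by
      rw [show 1 - (1 + x) / 2 = (1 - x) / 2 by ring, Real.logb_div (by linarith) two_ne_zero,
        Real.logb_self_eq_one one_lt_two]
    refine ⟨2 / (Real.logb 2 (1 + x) - Real.logb 2 (1 - x)), fun m B hB hcard => ?_⟩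
    have hl : 0 < Real.logb 2 (1 + x) - Real.logb 2 (1 - x) := by linarith
    have h := mean_ones_ge hB (t := (1 + x) / 2) (by linarith) (by linarith) hcard
    rw [ht, ht', entropy_half, sub_sub_sub_cancel_right] at h
    refine le_of_mul_le_mul_right (le_trans ?_ h) hl
    rw [sub_mul, div_mul_cancel₀ _ hl.ne']
    have hm : (0 : ℝ) ≤ m := Nat.cast_nonneg m
    have : (1 - 1 / 2 - η) * m * (Real.logb 2 (1 + x) - Real.logb 2 (1 - x)) ≤
        (1 - x) / 2 * m * (Real.logb 2 (1 + x) - Real.logb 2 (1 - x)) := by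
      gcongr
      linarith
    nlinarith [mul_le_mul_of_nonneg_left hratio hm]
  rcases hs1.eq_or_lt with rfl | hs1
  · refine ⟨0, fun m B _ _ => ?_⟩
    have h1 : 0 ≤ userAverage B (fun b => (ones b : ℝ)) := by
      unfold userAverage; positivity
    have h2 : 0 ≤ η * m := by positivity
    linarith
  · have hl : 0 < Real.logb 2 s - Real.logb 2 (1 - s) :=
      sub_pos.mpr (Real.logb_lt_logb one_lt_two (by linarith) (by linarith))
    refine ⟨2 / (Real.logb 2 s - Real.logb 2 (1 - s)), fun m B hB hcard => ?_⟩
    have h := mean_ones_ge hB (t := s) (by linarith) hs1 hcard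
    refine le_of_mul_le_mul_right (le_trans ?_ h) hl
    rw [sub_mul, div_mul_cancel₀ _ hl.ne', entropy]
    have hm : 0 ≤ η * m * (Real.logb 2 s - Real.logb 2 (1 - s)) := by positivity
    linarith

/-! ### Passage to rates and limits -/

theorem rate_le {m : ℕ} (hm : 0 < m) {x y C : ℝ} (h : Real.logb 2 x ≤ y * m + C) :
    rate m x ≤ y + C / m := by
  have hm' : (0 : ℝ) < m := by exact_mod_cast hm
  rw [rate, one_div, inv_mul_le_iff₀ hm', mul_add, mul_div_cancel₀ _ hm'.ne']
  linarith

theorem le_rate {m : ℕ} (hm : 0 < m) {x y C : ℝ} (h : y * m - C ≤ Real.logb 2 x) :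
    y - C / m ≤ rate m x := by
  have hm' : (0 : ℝ) < m := by exact_mod_cast hm
  rw [rate, one_div, le_inv_mul_iff₀ hm', mul_sub, mul_div_cancel₀ _ hm'.ne']
  linarith

theorem logb_userAverage_le {m : ℕ} {p s : ℝ} (hp : 0 < p) (hp2 : p ≤ 1 / 2)
    (hs : 1 / 2 ≤ s) (hs1 : s ≤ 1) {B : Finset (Bin m)} (hne : B.Nonempty)
    (hB : (2 : ℝ) ^ (entropy s * m) / 4 ≤ B.card) {g : Bin m → ℝ} (hg0 : ∀ b, 0 < g b)
    (hg : ∀ b, g b ≤ 2 * (bernoulliProb p b)⁻¹) :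
    Real.logb 2 (userAverage B g) ≤ upperRate s p * m + Real.logb 2 10 := by
  have hM : (0 : ℝ) < B.card := by exact_mod_cast hne.card_pos
  have hle : userAverage B g ≤ 2 ^ (upperRate s p * m) * 10 := by
    rw [userAverage, div_le_iff₀ hM]
    calc ∑ b ∈ B, g b ≤ ∑ b ∈ B, 2 * (bernoulliProb p b)⁻¹ := Finset.sum_le_sum fun b _ => hg b
      _ ≤ 2 * (5 * 2 ^ (upperRate s p * m) * B.card) := by
          rw [← Finset.mul_sum]
          gcongr
          exact sum_inv_bernoulliProb_le hp hp2 hs hs1 B hB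
      _ = _ := by ring
  have hpos : 0 < userAverage B g := div_pos (Finset.sum_pos (fun b _ => hg0 b) hne) hM
  refine (Real.logb_le_logb_of_le one_lt_two hpos hle).trans_eq ?_
  rw [Real.logb_mul (by positivity) (by norm_num), Real.logb_rpow two_pos (by norm_num)]

theorem exists_le_logb_userAverage {p s η : ℝ} (hp : 0 < p) (hp2 : p ≤ 1 / 2)
    (hs : 1 / 2 ≤ s) (hs1 : s ≤ 1) (hη : 0 < η) :
    ∃ C : ℝ, ∀ (m : ℕ) (B : Finset (Bin m)), B.Nonempty →
      (2 : ℝ) ^ (entropy s * m) / 4 ≤ B.card → ∀ g : Bin m → ℝ,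
      (∀ b, (bernoulliProb p b)⁻¹ / 3 ≤ g b) →
      (lowerRate s p - η) * m - C ≤ Real.logb 2 (userAverage B g) := by
  have hp1 : p < 1 := by linarith
  set d := Real.logb 2 (1 - p) - Real.logb 2 p with hd
  have hd0 : 0 ≤ d := sub_nonneg.mpr (Real.logb_le_logb_of_le one_lt_two hp (by linarith))
  -- The slope `d` turns an error in the mean into one in the rate; `d + 1` avoids dividing by zero
  -- at `p = 1/2`.
  obtain ⟨C, hC⟩ := exists_mean_ones_ge hs hs1 (div_pos hη (show 0 < d + 1 by linarith))
  refine ⟨C * d + Real.logb 2 3, fun m B hne hB g hg => ?_⟩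
  have hM : (0 : ℝ) < B.card := by exact_mod_cast hne.card_pos
  have hg0 : ∀ b, 0 < g b := fun b =>
    lt_of_lt_of_le (by have := bernoulliProb_pos hp hp1 b; positivity) (hg b)
  have hlog : ∀ b, -m * Real.logb 2 (1 - p) - Real.logb 2 3 + ones b * d ≤
      Real.logb 2 (g b) := by
    intro b
    have hq := bernoulliProb_pos hp hp1 b
    refine le_trans (le_of_eq ?_) (Real.logb_le_logb_of_le one_lt_two (by positivity) (hg b))
    rw [Real.logb_div (by positivity) (by norm_num), Real.logb_inv, logb_bernoulliProb hp hp1]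
    ring
  have hJ : B.card * (-m * Real.logb 2 (1 - p) - Real.logb 2 3 +
      userAverage B (fun b => (ones b : ℝ)) * d) ≤ B.card * Real.logb 2 (userAverage B g) := by
    refine le_trans (le_of_eq ?_) ((Finset.sum_le_sum fun b _ => hlog b).trans
      (sum_logb_le_card_mul_logb_userAverage hne hg0))
    simp only [Finset.sum_add_distrib, Finset.sum_const, nsmul_eq_mul, ← Finset.sum_mul,
      userAverage]
    field_simp
  refine le_trans ?_ (le_of_mul_le_mul_left hJ hM)
  have h1 := mul_le_mul_of_nonneg_right (hC m B hne hB) hd0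
  have h2 : η / (d + 1) * d ≤ η := by
    rw [div_mul_eq_mul_div, div_le_iff₀ (by linarith)]
    nlinarith
  have h3 := mul_le_mul_of_nonneg_right h2 (Nat.cast_nonneg m : (0 : ℝ) ≤ m)
  rw [lowerRate_eq hp hp1 (by linarith) hs1]
  have h4 : -(1 - s) * Real.logb 2 p - s * Real.logb 2 (1 - p) =
      (1 - s) * d - Real.logb 2 (1 - p) := by rw [hd]; ring
  rw [h4]
  linarith

theorem le_liminf_coe {u : ℕ → ℝ} {L : ℝ}
    (h : ∀ η > 0, ∃ C : ℝ, ∀ m > 0, L - η - C / m ≤ u m) :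
    (L : EReal) ≤ Filter.liminf (fun m => (u m : EReal)) Filter.atTop := by
  refine EReal.ge_of_forall_gt_iff_ge.mp fun a ha => ?_
  have ha' : a < L := by exact_mod_cast ha
  obtain ⟨C, hC⟩ := h ((L - a) / 2) (by linarith)
  refine Filter.le_liminf_of_le (by isBoundedDefault) ?_
  have hlim := (tendsto_const_div_atTop_nhds_zero_nat C).eventually_lt_const
    (show 0 < (L - a) / 2 by linarith)
  filter_upwards [hlim, Filter.eventually_gt_atTop 0] with m h1 h2
  exact_mod_cast (show a ≤ u m by linarith [hC m h2])

theorem limsup_coe_le {u : ℕ → ℝ} {U C : ℝ} (h : ∀ m > 0, u m ≤ U + C / m) :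
    Filter.limsup (fun m => (u m : EReal)) Filter.atTop ≤ (U : EReal) := by
  refine EReal.le_of_forall_lt_iff_le.mp fun a ha => ?_
  have ha' : U < a := by exact_mod_cast ha
  refine Filter.limsup_le_of_le (by isBoundedDefault) ?_
  have hlim := (tendsto_const_div_atTop_nhds_zero_nat C).eventually_lt_const (sub_pos.mpr ha')
  filter_upwards [hlim, Filter.eventually_gt_atTop 0] with m h1 h2
  exact_mod_cast (show u m ≤ a by linarith [h m h2])

/-- The bounds on the rate, for any guesswork which is the inverse of the probability of the bin
up to constants. -/
theorem rate_userAverage_bounds {p s : ℝ} (hp : 0 < p) (hp2 : p ≤ 1 / 2) (hs : 1 / 2 ≤ s)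
    (hs1 : s ≤ 1) {B : ∀ m : ℕ, Finset (Bin m)} (hB : ∀ m, (B m).Nonempty)
    (hBcard : ∀ m : ℕ, |((B m).card : ℝ) - (2 : ℝ) ^ (entropy s * m - 1)| < 1)
    {g : ∀ m : ℕ, Bin m → ℝ} (hlow : ∀ m b, (bernoulliProb p b)⁻¹ / 3 ≤ g m b)
    (hupp : ∀ m b, g m b ≤ 2 * (bernoulliProb p b)⁻¹) :
    (lowerRate s p : EReal) ≤
        Filter.liminf (fun m : ℕ => (rate m (userAverage (B m) (g m)) : EReal)) Filter.atTop ∧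
      Filter.limsup (fun m : ℕ => (rate m (userAverage (B m) (g m)) : EReal)) Filter.atTop ≤
        (upperRate s p : EReal) := by
  have hcard := fun m => div_four_le_of_abs_sub_lt (hB m).card_pos (hBcard m)
  refine ⟨le_liminf_coe fun η hη => ?_, limsup_coe_le (C := Real.logb 2 10) fun m hm => rate_le hm ?_⟩
  · obtain ⟨C, hC⟩ := exists_le_logb_userAverage hp hp2 hs hs1 hη
    exact ⟨C, fun m hm => le_rate hm (hC m (B m) (hB m) (hcard m) (g m) (hlow m))⟩
  · refine logb_userAverage_le hp hp2 hs hs1 (hB m) (hcard m) (fun b => ?_) (hupp m)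
    have := bernoulliProb_pos hp (by linarith) b
    exact lt_of_lt_of_le (by positivity) (hlow m b)

end Guesswork

theorem mainTheorem4
    (p s ε : ℝ) (hp : 0 < p) (hp2 : p ≤ 1 / 2) (hs : 1 / 2 ≤ s) (hs1 : s ≤ 1) (hε : 0 < ε)
    (n : ℕ → ℕ) (hn : ∀ m : ℕ, (1 + ε) * m * Real.logb 2 (1 / p) ≤ n m)
    -- the hash functions
    (h : ∀ m : ℕ, Guesswork.HashFn (n m) m)
    (hh : ∀ m : ℕ, Guesswork.RepresentsBernoulli p (h m))
    -- the distinct bins of the users; their number is `2 ^ (H(s) m - 1)`, rounded to an integer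
    (B : ∀ m : ℕ, Finset (Guesswork.Bin m)) (hB : ∀ m : ℕ, (B m).Nonempty)
    (hBcard : ∀ m : ℕ, |((B m).card : ℝ) - (2 : ℝ) ^ (Guesswork.entropy s * m - 1)| < 1) :
    -- any hash function, averaged over all strategies
    ((Guesswork.lowerRate s p : EReal) ≤
        Filter.liminf (fun m : ℕ => (Guesswork.rate m
          (Guesswork.userAverage (B m) (Guesswork.strategyAverage (h m))) : EReal)) Filter.atTop ∧
      Filter.limsup (fun m : ℕ => (Guesswork.rate m
          (Guesswork.userAverage (B m) (Guesswork.strategyAverage (h m))) : EReal)) Filter.atTop ≤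
        (Guesswork.upperRate s p : EReal)) ∧
    -- the set of hash functions, for any strategy (which may depend on the bin under attack)
    (∀ σ : ∀ m : ℕ, Guesswork.Bin m → Guesswork.Strategy (n m),
      (Guesswork.lowerRate s p : EReal) ≤
        Filter.liminf (fun m : ℕ => (Guesswork.rate m
          (Guesswork.userAverage (B m)
            (fun b => Guesswork.hashSetAverage (h m) (σ m b) b)) : EReal)) Filter.atTop ∧
      Filter.limsup (fun m : ℕ => (Guesswork.rate m
          (Guesswork.userAverage (B m)
            (fun b => Guesswork.hashSetAverage (h m) (σ m b) b)) : EReal)) Filter.atTop ≤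
        (Guesswork.upperRate s p : EReal)) := by
  have hbd := fun m b => Guesswork.strategyAverage_bounds hp hp2 hε (hn m) (hh m) b
  refine ⟨Guesswork.rate_userAverage_bounds hp hp2 hs hs1 hB hBcard (fun m b => (hbd m b).2.1)
    fun m b => (hbd m b).2.2, fun σ => ?_⟩
  have hav := fun m b => Guesswork.hashSetAverage_eq_strategyAverage (h m) (σ m b) b (hbd m b).1
  exact Guesswork.rate_userAverage_bounds hp hp2 hs hs1 hB hBcard
    (g := fun m b => Guesswork.hashSetAverage (h m) (σ m b) b)
    (fun m b => (hbd m b).2.1.trans_eq (hav m b).symm)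
    fun m b => (hav m b).trans_le (hbd m b).2.2
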